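/- Let $G=\{z=x+iy\in\mathbb C:\ y>0\}$ and let $f:G\to G$ be the map $$ f(x+iy)=\begin{cases} x+iy, & x\le 0,\\ x+i(x+1)y, & x\ge 0,\ 0<y\le 1,\\ x+i(x+y), & x\ge 0,\ y>1.\end{cases} $$ For a domain (nonempty open connected set) $D\subsetneq\mathbb C$ let $\delta_D(z)$ be the distance from $z$ to $\partial D$, and let $$k_D(z_1,z_2)=\inf_\gamma\int_\gamma\frac{|dz|}{\delta_D(z)}$$ be the quasihyperbolic distance, where the infimum is over all rectifiable curves $\gamma$ joining $z_1$ to $z_2$ in $D$. For a homeomorphism $\varphi:[0,\infty)\to[0,\infty)$ and domains $D,D'\subsetneq\mathbb C$, a homeomorphism $g$ of $D$ onto $D'$ is called $\varphi$-semisolid if $k_{D'}(g(x),g(y))\le\varphi(k_D(x,y))$ for all $x,y\in D$; $f$ is called $\varphi$-semisolid in a subdomain $D\subset G$ if $f|_D:D\to f(D)$ is $\varphi$-semisolid. For $0<q<1$ and $H\ge 1$, $f$ is called $q$-locally weakly $H$-quasisymmetric in $G$ if for every $z\in G$ and all $x,a,b$ in the component containing $z$ of $\{w\in G: |w-z|<q\,\delta_G(z)\}$,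 $|x-a|\le|x-b|$ implies $|f(x)-f(a)|\le H|f(x)-f(b)|$. Then $G$ is a domain with $G\subsetneq\mathbb C$, $f$ is a homeomorphism of $G$ onto $G$, and: (a) $f$ is $\varphi$-semisolid in $G$ with $\varphi(t)=\sqrt3\,t$; (b) there is no homeomorphism $\psi:[0,\infty)\to[0,\infty)$ such that $f$ is $\psi$-semisolid in every proper subdomain $D\subsetneq G$; (c) $f$ is not $q$-locally weakly $H$-quasisymmetric in $G$ for any $H\ge 1$ and $0<q<1$. -/

import Mathlib

noncomputable section

namespace Semisolidity

open Set

/-- A proper domain: a nonempty, open, connected, proper subset of the ambient space. -/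
def IsProperDomain {X : Type*} [TopologicalSpace X] (G : Set X) : Prop :=
  IsOpen G ∧ IsConnected G ∧ G ≠ univ

/-- `δ_G(z)`: the distance from `z` to the boundary of `G`. -/
def bdryDist {X : Type*} [MetricSpace X] (G : Set X) (z : X) : ℝ :=
  Metric.infDist z (frontier G)

/-- The restriction of `γ` to `[a, b]` is a rectifiable curve in `G` from `x` to `y`. -/
structure IsRectifiableCurve {X : Type*} [MetricSpace X] (G : Set X) (x y : X)
    (γ : ℝ → X) (a b : ℝ) : Prop where
  le : a ≤ b
  continuousOn : ContinuousOn γ (Icc a b)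
  rectifiable : eVariationOn γ (Icc a b) ≠ ⊤
  mapsTo : MapsTo γ (Icc a b) G
  source : γ a = x
  target : γ b = y

/-- The length of the curve `γ : [a, b] → X`. -/
def curveLength {X : Type*} [MetricSpace X] (γ : ℝ → X) (a b : ℝ) : ℝ :=
  (eVariationOn γ (Icc a b)).toReal

/-- The line integral of `ρ` along the rectifiable curve `γ : [a, b] → X`, that is
`∫_0^ℓ ρ (γ_s t) dt`, where `γ_s : [0, ℓ] → X` is the arclength parametrization of `γ`. -/
def lineIntegral {X : Type*} [MetricSpace X] (ρ : X → ℝ) (γ : ℝ → X) (a b : ℝ) : ℝ :=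
  ∫ t in (0 : ℝ)..(curveLength γ a b), ρ (naturalParameterization γ (Icc a b) a t)

/-- The quasihyperbolic length of the curve `γ : [a, b] → X` with respect to `G`. -/
def qhLength {X : Type*} [MetricSpace X] (G : Set X) (γ : ℝ → X) (a b : ℝ) : ℝ :=
  lineIntegral (fun z => (bdryDist G z)⁻¹) γ a b

/-- The quasihyperbolic distance `k_G(x, y)`: the infimum of the quasihyperbolic lengths of the
rectifiable curves joining `x` to `y` in `G`.  (For a proper domain of a normed space such curves
exist and all the lengths are nonnegative.) -/
def qhDist {X : Type*} [MetricSpace X] (G : Set X) (x y : X) : ℝ :=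
  sInf {L : ℝ | ∃ (γ : ℝ → X) (a b : ℝ), IsRectifiableCurve G x y γ a b ∧ L = qhLength G γ a b}

/-- The restriction of `f` to `G` is a homeomorphism of `G` onto `G'`. -/
def IsHomeoOn {X Y : Type*} [TopologicalSpace X] [TopologicalSpace Y]
    (f : X → Y) (G : Set X) (G' : Set Y) : Prop :=
  ∃ e : G ≃ₜ G', ∀ z : G, (e z : Y) = f z

/-- The inequality defining `φ`-semisolidity of a homeomorphism `f : G → G'` of proper domains,
for a homeomorphism `φ : [0, ∞) → [0, ∞)`.  (That `f` is a homeomorphism of proper domains is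
stated separately.) -/
def IsSemisolid {X Y : Type*} [MetricSpace X] [MetricSpace Y] (φ : NNReal ≃ₜ NNReal)
    (f : X → Y) (G : Set X) (G' : Set Y) : Prop :=
  ∀ x ∈ G, ∀ y ∈ G, qhDist G' (f x) (f y) ≤ φ (qhDist G x y).toNNReal

/-- The component containing `z` of the intersection of `G` with the open ball `B(z, r)`. -/
def componentBall {X : Type*} [MetricSpace X] (G : Set X) (z : X) (r : ℝ) : Set X :=
  connectedComponentIn (Metric.ball z r ∩ G) z

/-- The condition defining weak `H`-quasisymmetry, for triplets of points of `S`. -/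
def IsWeaklyQuasisymmetricOn {X Y : Type*} [MetricSpace X] [MetricSpace Y] (H : ℝ)
    (f : X → Y) (S : Set X) : Prop :=
  ∀ x ∈ S, ∀ a ∈ S, ∀ b ∈ S, dist x a ≤ dist x b → dist (f x) (f a) ≤ H * dist (f x) (f b)

/-- The condition defining `q`-local weak `H`-quasisymmetry of a homeomorphism `f` of a proper
domain `G` onto a proper domain. -/
def IsLocallyWeaklyQuasisymmetric {X Y : Type*} [MetricSpace X] [MetricSpace Y] (q H : ℝ)
    (f : X → Y) (G : Set X) : Prop :=
  ∀ z ∈ G, IsWeaklyQuasisymmetricOn H f (componentBall G z (q * bdryDist G z))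

/-- The open upper half-plane in `ℂ`. -/
def upperHalf : Set ℂ := {z | 0 < z.im}

/-- Väisälä's map (only its values on the open upper half-plane matter). -/
def vaisalaMap (z : ℂ) : ℂ :=
  if z.re ≤ 0 then z
  else if z.im ≤ 1 then ⟨z.re, (z.re + 1) * z.im⟩
  else ⟨z.re, z.re + z.im⟩

end Semisolidity

end

namespace Semisolidity

open Set Filter Topology MeasureTheory

/-! In the half-plane $\delta_G(z)=\operatorname{Im} z$. Put $K(z)=\operatorname{Im}
f(z)/\operatorname{Im} z\ge 1$. For (a), $f$ stretches lengths near $z$ by at most $\sqrt3\,K(z)$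
(`dist_vaisalaMap_le`), while $\delta_G$ grows by exactly $K(z)$. The factor $K$ cancels in
$|df|/\operatorname{Im} f$, and integration along curves gives $\sqrt3$.

The vertical stretch of $f$ is unbounded while the horizontal one is not, and this refutes the other
two properties. For (b), cut $G$ along $\operatorname{Re} z=R$. The points $R+\frac14+\frac i2$ and
$R+\frac14+\frac{3i}4$ have quasihyperbolic distance at most 1 in the quadrant, but the image of the
boundary point $R+\frac i2$ stays within $\frac12$ of the first image and is at least $R/4$ away
from the second. Since $\log|\cdot-p|$ varies by at most the quasihyperbolic length for $p$ on the
boundary (`IsRectifiableCurve.log_dist_sub_log_dist_le`), the images are at distance at least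
$\log(R/2)$. For (c), compare equal vertical and horizontal steps at $R+\frac i2$.

Line integrals are defined by arclength and curves need not be differentiable, so integral estimates
are proved by bounding right slopes (`sub_le_integral_of_slope_right`). -/

/-- A continuous function whose upper right slopes are dominated by a continuous function `w`
grows at most by the integral of `w`. -/
theorem sub_le_integral_of_slope_right {u w : ℝ → ℝ} {a b : ℝ} (hab : a ≤ b)
    (hu : ContinuousOn u (Icc a b)) (hw : Continuous w)
    (h : ∀ t ∈ Ico a b, ∀ r, w t < r → ∀ᶠ s in 𝓝[>] t, slope u t s < r) :
    u b - u a ≤ ∫ t in a..b, w t := by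
  have hd : ∀ x, HasDerivAt (fun x => u a + ∫ t in a..x, w t) (w x) x := fun x =>
    (hw.integral_hasStrictDerivAt a x).hasDerivAt.const_add _
  have key := image_le_of_liminf_slope_right_le_deriv_boundary (f := u) (a := a) (b := b) hu
    (B := fun x => u a + ∫ t in a..x, w t) (B' := w) (by simp)
    (fun x _ => (hd x).continuousAt.continuousWithinAt)
    (fun x _ => (hd x).hasDerivWithinAt)
    (fun x hx r hr => (h x hx r hr).frequently) (right_mem_Icc.2 hab)
  linarith

theorem slope_lt_of_eventually_sub_le {u w : ℝ → ℝ} {t : ℝ}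
    (h : ∀ᶠ s in 𝓝[>] t, u s - u t ≤ w t * (s - t)) (r : ℝ) (hr : w t < r) :
    ∀ᶠ s in 𝓝[>] t, slope u t s < r := by
  filter_upwards [h, self_mem_nhdsWithin] with s hs hts
  have hpos : 0 < s - t := sub_pos.2 hts
  rw [slope_def_field, div_lt_iff₀ hpos]
  nlinarith

/-! ### Arclength and rectifiable curves -/

section MetricSpace

variable {X : Type*} [MetricSpace X]

theorem curveLength_nonneg (γ : ℝ → X) (a b : ℝ) : 0 ≤ curveLength γ a b :=
  ENNReal.toReal_nonneg

/-- A one-sided jump of the variation function equals the corresponding jump of `γ`, which vanishes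
by continuity. -/
theorem continuousOn_variationOnFromTo {γ : ℝ → X} {a b : ℝ} (hab : a ≤ b)
    (hγ : ContinuousOn γ (Icc a b)) (hv : BoundedVariationOn γ (Icc a b)) :
    ContinuousOn (variationOnFromTo γ (Icc a b) a) (Icc a b) := by
  have hl := hv.locallyBoundedVariationOn
  have ha : a ∈ Icc a b := left_mem_Icc.2 hab
  intro t ht
  have h1 := variationOnFromTo.tendsto_left ha ht hl
    ((hγ t ht).mono_left (nhdsWithin_mono _ inter_subset_left))
  have h2 := variationOnFromTo.tendsto_right ha ht hl
    ((hγ t ht).mono_left (nhdsWithin_mono _ inter_subset_left))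
  rw [dist_self, sub_zero] at h1
  rw [dist_self, add_zero] at h2
  have hs : Icc a b ⊆ (Icc a b ∩ Iio t ∪ Icc a b ∩ Ioi t) ∪ {t} := by
    intro s hs
    rcases lt_trichotomy s t with h | h | h
    · exact Or.inl (Or.inl ⟨hs, h⟩)
    · exact Or.inr h
    · exact Or.inl (Or.inr ⟨hs, h⟩)
  refine ContinuousWithinAt.mono ?_ hs
  exact ContinuousWithinAt.union (ContinuousWithinAt.union h1 h2) continuousWithinAt_singleton

theorem image_variationOnFromTo {γ : ℝ → X} {a b : ℝ} (hab : a ≤ b)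
    (hγ : ContinuousOn γ (Icc a b)) (hv : BoundedVariationOn γ (Icc a b)) :
    variationOnFromTo γ (Icc a b) a '' Icc a b = Icc 0 (curveLength γ a b) := by
  have hV := continuousOn_variationOnFromTo hab hγ hv
  have h0 : variationOnFromTo γ (Icc a b) a a = 0 := variationOnFromTo.self _ _ _
  have h1 : variationOnFromTo γ (Icc a b) a b = curveLength γ a b := by
    rw [variationOnFromTo.eq_of_le _ _ hab, inter_self]; rfl
  have hm := variationOnFromTo.monotoneOn hv.locallyBoundedVariationOn (left_mem_Icc.2 hab)
  apply Subset.antisymm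
  · rintro _ ⟨t, ht, rfl⟩
    rw [← h0, ← h1]
    exact ⟨hm (left_mem_Icc.2 hab) ht ht.1, hm ht (right_mem_Icc.2 hab) ht.2⟩
  · rw [← h0, ← h1]
    exact intermediate_value_Icc hab hV

/-- The arclength parametrization of a rectifiable curve, extended to the line by constants. -/
theorem IsRectifiableCurve.exists_arclength {G : Set X} {x y : X} {γ : ℝ → X} {a b : ℝ}
    (h : IsRectifiableCurve G x y γ a b) :
    ∃ g : ℝ → X, LipschitzWith 1 g ∧ (∀ t, g t ∈ G) ∧ g 0 = x ∧ g (curveLength γ a b) = y ∧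
      (∀ t ∈ Icc a b, g (variationOnFromTo γ (Icc a b) a t) = γ t) ∧
      ∀ ρ : X → ℝ, lineIntegral ρ γ a b = ∫ t in (0 : ℝ)..(curveLength γ a b), ρ (g t) := by
  have hab := h.le
  have hv : BoundedVariationOn γ (Icc a b) := h.rectifiable
  have hl := hv.locallyBoundedVariationOn
  have ha : a ∈ Icc a b := left_mem_Icc.2 hab
  have himg := image_variationOnFromTo hab h.continuousOn hv
  have hL := curveLength_nonneg γ a b
  set N := naturalParameterization γ (Icc a b) a with hN
  set L := curveLength γ a b with hLdef
  have hNV : ∀ t ∈ Icc a b, N (variationOnFromTo γ (Icc a b) a t) = γ t := fun t ht =>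
    edist_eq_zero.1 (edist_naturalParameterization_eq_zero hl ha ht)
  have hunit := has_unit_speed_naturalParameterization γ hl ha
  rw [himg] at hunit
  have hlip : ∀ s ∈ Icc 0 L, ∀ t ∈ Icc 0 L, s ≤ t → edist (N s) (N t) ≤ edist s t := by
    intro s hs t ht hst
    have h1 := hunit hs ht
    rw [NNReal.coe_one, one_mul] at h1
    calc edist (N s) (N t) ≤ eVariationOn N (Icc 0 L ∩ Icc s t) :=
          eVariationOn.edist_le _ ⟨hs, le_rfl, hst⟩ ⟨ht, hst, le_rfl⟩
      _ = ENNReal.ofReal (t - s) := h1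
      _ = edist s t := by
          rw [edist_comm, edist_dist, Real.dist_eq, abs_of_nonneg (sub_nonneg.2 hst)]
  have hlipN : LipschitzOnWith 1 N (Icc 0 L) := by
    intro s hs t ht
    rw [ENNReal.coe_one, one_mul]
    rcases le_total s t with hst | hst
    · exact hlip s hs t ht hst
    · rw [edist_comm, edist_comm s]; exact hlip t ht s hs hst
  have hext : ∀ t ∈ Icc 0 L, N (projIcc 0 L hL t) = N t := fun t ht => by
    rw [projIcc_of_mem hL ht]
  refine ⟨fun t => N (projIcc 0 L hL t), ?_, ?_, ?_, ?_, ?_, ?_⟩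
  · have h1 := hlipN.to_restrict.comp (LipschitzWith.projIcc hL)
    rw [one_mul] at h1
    exact h1
  · intro t
    obtain ⟨s, hs, hs'⟩ := himg.ge (projIcc 0 L hL t).2
    change N (projIcc 0 L hL t) ∈ G
    rw [← hs', hNV s hs]
    exact h.mapsTo hs
  · change N _ = x
    rw [hext 0 (left_mem_Icc.2 hL), ← variationOnFromTo.self γ (Icc a b) a, hNV a ha, h.source]
  · change N _ = y
    rw [hext L (right_mem_Icc.2 hL), ← h.target, ← hNV b (right_mem_Icc.2 hab),
      variationOnFromTo.eq_of_le _ _ hab, inter_self, hLdef]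
    rfl
  · intro t ht
    change N _ = γ t
    rw [hext, hNV t ht]
    rw [← himg]
    exact mem_image_of_mem _ ht
  · intro ρ
    refine intervalIntegral.integral_congr fun t ht => ?_
    rw [uIcc_of_le hL] at ht
    change ρ (N t) = ρ (N _)
    rw [hext t ht]

/-! ### Curves of bounded speed -/

/-- Every variation sum of `γ` is dominated termwise by that of `W`, which is monotone and so has
variation `W b - W a`. -/
theorem eVariationOn_le_of_dist_le {γ : ℝ → X} {W : ℝ → ℝ} {a b : ℝ} (hab : a ≤ b)
    (h : ∀ s ∈ Icc a b, ∀ t ∈ Icc a b, s ≤ t → dist (γ s) (γ t) ≤ W t - W s) :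
    eVariationOn γ (Icc a b) ≤ ENNReal.ofReal (W b - W a) := by
  have hm : MonotoneOn W (Icc a b) := fun s hs t ht hst => by
    have := h s hs t ht hst
    linarith [dist_nonneg (x := γ s) (y := γ t)]
  have hW := hm.eVariationOn_eq (left_mem_Icc.2 hab) (right_mem_Icc.2 hab)
  rw [inter_self] at hW
  rw [← hW]
  refine iSup_le fun p => le_trans (Finset.sum_le_sum fun i _ => ?_)
    (le_iSup (fun p : ℕ × { u : ℕ → ℝ // Monotone u ∧ ∀ i, u i ∈ Icc a b } =>
      ∑ i ∈ Finset.range p.1, edist (W (p.2.1 (i + 1))) (W (p.2.1 i))) p)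
  have hi := p.2.2.1 (Nat.le_succ i)
  have := h _ (p.2.2.2 i) _ (p.2.2.2 (i + 1)) hi
  rw [edist_dist, edist_dist, dist_comm, Real.dist_eq]
  exact ENNReal.ofReal_le_ofReal (this.trans (le_abs_self _))

/-- A curve whose metric speed is dominated by a continuous function `w`. -/
theorem dist_le_integral_of_speed_le {γ : ℝ → X} {w : ℝ → ℝ} {a b : ℝ} (hab : a ≤ b)
    (hγ : Continuous γ) (hw : Continuous w)
    (h : ∀ t, ∀ᶠ s in 𝓝[>] t, dist (γ s) (γ t) ≤ w t * (s - t)) :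
    dist (γ a) (γ b) ≤ ∫ t in a..b, w t := by
  have key := sub_le_integral_of_slope_right (u := fun s => dist (γ a) (γ s)) hab
    (by fun_prop) hw (fun t _ r hr => slope_lt_of_eventually_sub_le (w := w) ?_ r hr)
  · simpa using key
  · filter_upwards [h t] with s hs
    have := dist_triangle_right (γ a) (γ s) (γ t)
    have := dist_triangle (γ a) (γ t) (γ s)
    rw [dist_comm (γ t)] at this
    linarith

theorem eVariationOn_ne_top_of_speed_le {γ : ℝ → X} {w : ℝ → ℝ} {a b : ℝ} (hab : a ≤ b)
    (hγ : Continuous γ) (hw : Continuous w)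
    (h : ∀ t, ∀ᶠ s in 𝓝[>] t, dist (γ s) (γ t) ≤ w t * (s - t)) :
    eVariationOn γ (Icc a b) ≠ ⊤ := by
  refine ne_top_of_le_ne_top ENNReal.ofReal_ne_top
    (eVariationOn_le_of_dist_le (W := fun t => ∫ τ in a..t, w τ) hab fun s _ t _ hst => ?_)
  rw [intervalIntegral.integral_interval_sub_left (hw.intervalIntegrable _ _)
    (hw.intervalIntegrable _ _)]
  exact dist_le_integral_of_speed_le hst hγ hw h

/-- The line integral along a curve of speed at most `w`. -/
theorem IsRectifiableCurve.lineIntegral_le {G : Set X} {x y : X} {γ : ℝ → X} {a b : ℝ}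
    (hr : IsRectifiableCurve G x y γ a b) {ρ : X → ℝ} {w : ℝ → ℝ}
    (hγ : Continuous γ) (hG : ∀ t, γ t ∈ G) (hw : Continuous w)
    (hρ : ContinuousOn ρ G) (hρ0 : ∀ z ∈ G, 0 ≤ ρ z)
    (h : ∀ t, ∀ᶠ s in 𝓝[>] t, dist (γ s) (γ t) ≤ w t * (s - t)) :
    lineIntegral ρ γ a b ≤ ∫ t in a..b, ρ (γ t) * w t := by
  obtain ⟨g, hg, hgG, -, -, hgV, hgρ⟩ := hr.exists_arclength
  have hab := hr.le
  have hv : BoundedVariationOn γ (Icc a b) := hr.rectifiable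
  have hl := hv.locallyBoundedVariationOn
  have ha : a ∈ Icc a b := left_mem_Icc.2 hab
  set V := variationOnFromTo γ (Icc a b) a with hVdef
  have hσ : Continuous fun t => ρ (g t) := hρ.comp_continuous hg.continuous hgG
  have hP : ∀ v, HasDerivAt (fun v => ∫ t in (0 : ℝ)..v, ρ (g t)) (ρ (g v)) v := fun v =>
    (hσ.integral_hasStrictDerivAt 0 v).hasDerivAt
  have hPm : Monotone fun v => ∫ t in (0 : ℝ)..v, ρ (g t) :=
    monotone_of_hasDerivAt_nonneg hP fun v => hρ0 _ (hgG v)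
  have hW : ∀ v, HasDerivAt (fun v => ∫ t in a..v, w t) (w v) v := fun v =>
    (hw.integral_hasStrictDerivAt a v).hasDerivAt
  have hVW : ∀ s ∈ Icc a b, ∀ t ∈ Icc a b, s ≤ t →
      V t - V s ≤ (∫ τ in a..t, w τ) - ∫ τ in a..s, w τ := by
    intro s hs t ht hst
    rw [hVdef, variationOnFromTo.sub_right hl ha ht hs, variationOnFromTo.eq_of_le _ _ hst,
      inter_eq_self_of_subset_right (Icc_subset_Icc hs.1 ht.2)]
    have hd : ∀ s t, s ≤ t → dist (γ s) (γ t) ≤ (∫ τ in a..t, w τ) - ∫ τ in a..s, w τ := by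
      intro s t hst
      rw [intervalIntegral.integral_interval_sub_left (hw.intervalIntegrable _ _)
        (hw.intervalIntegrable _ _)]
      exact dist_le_integral_of_speed_le hst hγ hw h
    exact ENNReal.toReal_le_of_le_ofReal (dist_nonneg.trans (hd s t hst))
      (eVariationOn_le_of_dist_le (W := fun t => ∫ τ in a..t, w τ) hst
        fun s _ t _ hst => hd s t hst)
  have hV0 : V a = 0 := variationOnFromTo.self _ _ _
  have hV1 : V b = curveLength γ a b := by
    rw [hVdef, variationOnFromTo.eq_of_le _ _ hab, inter_self]; rfl
  have hcont : ContinuousOn (fun t => ∫ τ in (0 : ℝ)..V t, ρ (g τ)) (Icc a b) :=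
    (continuous_iff_continuousAt.2 fun v => (hP v).continuousAt).comp_continuousOn
      (continuousOn_variationOnFromTo hab hr.continuousOn hv)
  have key := sub_le_integral_of_slope_right hab hcont
    ((hρ.comp_continuous hγ hG).mul hw) ?_
  · simpa [hV0, hV1, hgρ] using key
  · intro t ht r hlt
    -- `V` need not be differentiable. It is replaced to the right of `t` by the differentiable
    -- majorant `V t + ∫ w` over `[t, s]`, which agrees with it at `t`; this only increases the
    -- integral of `ρ ∘ g` because `ρ ≥ 0`.
    have ht' := Ico_subset_Icc_self ht
    have hD : HasDerivAt (fun s => ∫ τ in (0 : ℝ)..(V t + ((∫ τ in a..s, w τ) -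
        ∫ τ in a..t, w τ)), ρ (g τ)) (ρ (γ t) * w t) t := by
      have h1 := ((hW t).sub_const (∫ τ in a..t, w τ)).const_add (V t)
      have h2 := hP (V t)
      rw [hgV t ht'] at h2
      refine HasDerivAt.comp (h₂ := fun v => ∫ τ in (0 : ℝ)..v, ρ (g τ)) t ?_ h1
      simpa using h2
    have hD' := (hasDerivAt_iff_tendsto_slope.1 hD).mono_left
      (nhdsWithin_mono t (fun s (hs : t < s) => ne_of_gt hs))
    filter_upwards [hD'.eventually (gt_mem_nhds hlt), Ioc_mem_nhdsGT ht.2] with s hs hts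
    refine lt_of_le_of_lt ?_ hs
    have hpos : 0 < s - t := sub_pos.2 hts.1
    rw [slope_def_field, slope_def_field]
    refine div_le_div_of_nonneg_right ?_ hpos.le
    have h1 : V s ≤ V t + ((∫ τ in a..s, w τ) - ∫ τ in a..t, w τ) := by
      have := hVW t ht' s ⟨ht'.1.trans hts.1.le, hts.2⟩ hts.1.le
      linarith
    have h2 := hPm h1
    simp only [sub_self, add_zero] at h2 ⊢
    linarith

/-! ### Quasihyperbolic length and distance -/

theorem bdryDist_nonneg (G : Set X) (z : X) : 0 ≤ bdryDist G z := Metric.infDist_nonneg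

theorem continuous_bdryDist (G : Set X) : Continuous (bdryDist G) :=
  Metric.continuous_infDist_pt _

theorem bdryDist_pos {G : Set X} (hG : IsOpen G) (hne : (frontier G).Nonempty) {z : X}
    (hz : z ∈ G) : 0 < bdryDist G z :=
  (isClosed_frontier.notMem_iff_infDist_pos hne).1 fun h => (hG.frontier_eq ▸ h).2 hz

theorem continuousOn_inv_bdryDist {G : Set X} (hG : IsOpen G) (hne : (frontier G).Nonempty) :
    ContinuousOn (fun z => (bdryDist G z)⁻¹) G :=
  (continuous_bdryDist G).continuousOn.inv₀ fun _ hz => (bdryDist_pos hG hne hz).ne'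

theorem IsRectifiableCurve.qhLength_nonneg {G : Set X} {x y : X} {γ : ℝ → X} {a b : ℝ}
    (h : IsRectifiableCurve G x y γ a b) : 0 ≤ qhLength G γ a b := by
  obtain ⟨g, -, -, -, -, -, hgρ⟩ := h.exists_arclength
  rw [qhLength, hgρ]
  exact intervalIntegral.integral_nonneg (curveLength_nonneg _ _ _) fun t _ =>
    inv_nonneg.2 (bdryDist_nonneg _ _)

theorem qhDist_nonneg (G : Set X) (x y : X) : 0 ≤ qhDist G x y :=
  Real.sInf_nonneg fun _ ⟨_, _, _, h, hL⟩ => hL ▸ h.qhLength_nonneg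

theorem IsRectifiableCurve.qhDist_le {G : Set X} {x y : X} {γ : ℝ → X} {a b : ℝ}
    (h : IsRectifiableCurve G x y γ a b) : qhDist G x y ≤ qhLength G γ a b :=
  csInf_le ⟨0, fun _ ⟨_, _, _, h, hL⟩ => hL ▸ h.qhLength_nonneg⟩ ⟨γ, a, b, h, rfl⟩

/-- The distance to a boundary point varies by a factor at most the exponential of the
quasihyperbolic length. -/
theorem IsRectifiableCurve.log_dist_sub_log_dist_le {G : Set X} (hG : IsOpen G) {p : X}
    (hp : p ∈ frontier G) {x y : X} {γ : ℝ → X} {a b : ℝ}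
    (h : IsRectifiableCurve G x y γ a b) :
    Real.log (dist y p) - Real.log (dist x p) ≤ qhLength G γ a b := by
  obtain ⟨g, hg, hgG, hg0, hg1, -, hgρ⟩ := h.exists_arclength
  have hpG : p ∉ G := (hG.frontier_eq ▸ hp).2
  have hd : ∀ t, 0 < dist (g t) p := fun t => dist_pos.2 fun h => hpG (h ▸ hgG t)
  have hδ : ∀ t, 0 < bdryDist G (g t) := fun t => bdryDist_pos hG ⟨p, hp⟩ (hgG t)
  rw [qhLength, hgρ, ← hg0, ← hg1]
  refine sub_le_integral_of_slope_right (u := fun t => Real.log (dist (g t) p))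
    (curveLength_nonneg _ _ _) ?_
    ((continuousOn_inv_bdryDist hG ⟨p, hp⟩).comp_continuous hg.continuous hgG) ?_
  · exact ((hg.continuous.dist continuous_const).log fun t => (hd t).ne').continuousOn
  · intro t _ r hr
    refine slope_lt_of_eventually_sub_le (w := fun t => (bdryDist G (g t))⁻¹) ?_ r hr
    filter_upwards [self_mem_nhdsWithin] with s hs
    have hst : 0 < s - t := sub_pos.2 hs
    have h1 : dist (g s) p - dist (g t) p ≤ s - t := by
      have h2 := hg.dist_le_mul s t
      rw [NNReal.coe_one, one_mul, Real.dist_eq, abs_of_pos hst] at h2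
      linarith [dist_triangle (g s) (g t) p]
    have h3 : bdryDist G (g t) ≤ dist (g t) p := Metric.infDist_le_dist_of_mem hp
    -- By `log u ≤ u - 1`, the slope of `log (dist (g ·) p)` is at most the reciprocal of the
    -- distance to `p`, hence at most `1 / δ`.
    calc Real.log (dist (g s) p) - Real.log (dist (g t) p)
        = Real.log (dist (g s) p / dist (g t) p) := (Real.log_div (hd s).ne' (hd t).ne').symm
      _ ≤ dist (g s) p / dist (g t) p - 1 := Real.log_le_sub_one_of_pos (div_pos (hd s) (hd t))
      _ = (dist (g s) p - dist (g t) p) / dist (g t) p := by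
          rw [sub_div, div_self (hd t).ne']
      _ ≤ (s - t) / dist (g t) p := div_le_div_of_nonneg_right h1 (hd t).le
      _ ≤ (s - t) / bdryDist G (g t) := div_le_div_of_nonneg_left hst.le (hδ t) h3
      _ = (bdryDist G (g t))⁻¹ * (s - t) := by rw [div_eq_mul_inv, mul_comm]

end MetricSpace

/-- The line integral is at most the supremum of the density times the length. -/
theorem IsRectifiableCurve.qhLength_le_mul {X : Type*} [MetricSpace X] {G : Set X} {x y : X}
    {γ : ℝ → X} {a b : ℝ} (h : IsRectifiableCurve G x y γ a b) {S : Set X} {r : ℝ} (hr : 0 < r)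
    (hS : MapsTo γ (Icc a b) S) (hδ : ∀ z ∈ S, r ≤ bdryDist G z) :
    qhLength G γ a b ≤ r⁻¹ * curveLength γ a b := by
  -- Viewed as a curve in `S`, it has an arclength parametrization with values in `S`, where the
  -- density is at most `r⁻¹`.
  have h' : IsRectifiableCurve S x y γ a b := ⟨h.1, h.2, h.3, hS, h.5, h.6⟩
  obtain ⟨g, -, hgS, -, -, -, hgρ⟩ := h'.exists_arclength
  rw [qhLength, hgρ]
  have hL := curveLength_nonneg γ a b
  have := intervalIntegral.norm_integral_le_of_norm_le_const (a := 0) (b := curveLength γ a b)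
    (f := fun t => (bdryDist G (g t))⁻¹) (C := r⁻¹) fun t _ => by
      rw [Real.norm_of_nonneg (inv_nonneg.2 (bdryDist_nonneg _ _))]
      exact inv_anti₀ hr (hδ _ (hgS t))
  rw [sub_zero, abs_of_nonneg hL] at this
  exact (le_abs_self _).trans this

theorem isRectifiableCurve_lineMap {E : Type*} [NormedAddCommGroup E] [NormedSpace ℝ E]
    {G : Set E} {x y : E} (h : segment ℝ x y ⊆ G) :
    IsRectifiableCurve G x y (AffineMap.lineMap x y : ℝ → E) 0 1 ∧
      curveLength (AffineMap.lineMap x y : ℝ → E) 0 1 ≤ dist x y := by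
  have hle : eVariationOn (AffineMap.lineMap x y : ℝ → E) (Icc 0 1) ≤
      ENNReal.ofReal (dist x y) := by
    have := eVariationOn_le_of_dist_le (γ := (AffineMap.lineMap x y : ℝ → E))
      (W := fun t => t * dist x y) zero_le_one fun s _ t _ hst => by
        rw [dist_lineMap_lineMap, dist_comm s, Real.dist_eq, abs_of_nonneg (sub_nonneg.2 hst),
          sub_mul]
    simpa using this
  refine ⟨⟨zero_le_one, AffineMap.lineMap_continuous.continuousOn,
    ne_top_of_le_ne_top ENNReal.ofReal_ne_top hle, fun t ht => h ?_, by simp, by simp⟩,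
    ENNReal.toReal_le_of_le_ofReal dist_nonneg hle⟩
  rw [segment_eq_image_lineMap]
  exact mem_image_of_mem _ ht

/-! ### The half-plane and the homeomorphism -/

theorem continuous_complex_mk {X : Type*} [TopologicalSpace X] {u v : X → ℝ} (hu : Continuous u)
    (hv : Continuous v) : Continuous fun x => (⟨u x, v x⟩ : ℂ) :=
  Complex.equivRealProdCLM.symm.continuous.comp (hu.prodMk hv)

theorem isOpen_upperHalf : IsOpen upperHalf := isOpen_lt continuous_const Complex.continuous_im

theorem convex_upperHalf : Convex ℝ upperHalf := convex_halfSpace_im_gt 0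

theorem frontier_upperHalf : frontier upperHalf = {z | z.im = 0} :=
  Complex.frontier_setOfPred_lt_im 0

theorem isProperDomain_upperHalf : IsProperDomain upperHalf := by
  refine ⟨isOpen_upperHalf, convex_upperHalf.isConnected ⟨Complex.I, ?_⟩, fun h => ?_⟩
  · simp [upperHalf]
  · have : (0 : ℂ) ∈ upperHalf := h ▸ mem_univ _
    simp [upperHalf] at this

theorem bdryDist_upperHalf {z : ℂ} (hz : z ∈ upperHalf) : bdryDist upperHalf z = z.im := by
  rw [bdryDist, frontier_upperHalf]
  have h0 : (z.re : ℂ) ∈ {z : ℂ | z.im = 0} := Complex.ofReal_im _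
  apply le_antisymm
  · refine (Metric.infDist_le_dist_of_mem h0).trans_eq ?_
    have : z - (z.re : ℂ) = z.im * Complex.I := by
      apply Complex.ext <;> simp
    rw [dist_eq_norm, this, norm_mul, Complex.norm_I, mul_one, Complex.norm_real]
    exact abs_of_pos hz
  · refine (Metric.le_infDist ⟨_, h0⟩).2 fun w hw => ?_
    have h1 := Complex.abs_im_le_norm (z - w)
    rw [Complex.sub_im, show w.im = 0 from hw, sub_zero] at h1
    rw [dist_eq_norm]
    exact (le_abs_self _).trans h1

/-- One formula for the three branches: continuity is immediate from it, and increments are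
controlled because `max` and `min` with a constant are 1-Lipschitz. -/
theorem vaisalaMap_eq (z : ℂ) :
    vaisalaMap z = ⟨z.re, z.im + max z.re 0 * min z.im 1⟩ := by
  unfold vaisalaMap
  split_ifs with h1 h2
  · rw [max_eq_right h1]; simp
  · rw [max_eq_left (not_le.1 h1).le, min_eq_left h2]; congr 1; ring
  · rw [max_eq_left (not_le.1 h1).le, min_eq_right (not_le.1 h2).le]; congr 1; ring

@[simp] theorem vaisalaMap_re (z : ℂ) : (vaisalaMap z).re = z.re := by rw [vaisalaMap_eq]

theorem vaisalaMap_im (z : ℂ) :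
    (vaisalaMap z).im = z.im + max z.re 0 * min z.im 1 := by rw [vaisalaMap_eq]

theorem vaisalaMap_im_of_le {z : ℂ} (h0 : 0 ≤ z.re) (h1 : z.im ≤ 1) :
    (vaisalaMap z).im = (z.re + 1) * z.im := by
  rw [vaisalaMap_im, max_eq_left h0, min_eq_left h1]; ring

theorem continuous_vaisalaMap : Continuous vaisalaMap := by
  rw [funext vaisalaMap_eq]
  exact continuous_complex_mk (by fun_prop) (by fun_prop)

theorem im_le_vaisalaMap_im {z : ℂ} (hz : z ∈ upperHalf) : z.im ≤ (vaisalaMap z).im := by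
  rw [vaisalaMap_im]
  have : 0 ≤ min z.im 1 := le_min (le_of_lt hz) zero_le_one
  have := mul_nonneg (le_max_right z.re 0) this
  linarith

theorem vaisalaMap_mem {z : ℂ} (hz : z ∈ upperHalf) : vaisalaMap z ∈ upperHalf :=
  lt_of_lt_of_le hz (im_le_vaisalaMap_im hz)

/-- The inverse of `vaisalaMap` on the upper half-plane. -/
noncomputable def vaisalaInv (z : ℂ) : ℂ := ⟨z.re, max (z.im / (max z.re 0 + 1)) (z.im - max z.re 0)⟩

theorem continuous_vaisalaInv : Continuous vaisalaInv := by
  refine continuous_complex_mk (by fun_prop) (Continuous.max (Continuous.div ?_ ?_ ?_) ?_)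
  · fun_prop
  · fun_prop
  · intro z
    have := le_max_right z.re 0
    positivity
  · fun_prop

theorem vaisalaInv_mem {z : ℂ} (hz : z ∈ upperHalf) : vaisalaInv z ∈ upperHalf := by
  have h := le_max_right z.re 0
  exact lt_of_lt_of_le (div_pos (show 0 < z.im from hz) (by positivity)) (le_max_left _ _)

/-- With `p = max z.re 0`, the fibre map `y ↦ y + p * min y 1` is the minimum of the increasing maps
`(p + 1) * y` and `y + p`, so its inverse is the maximum of their inverses. This holds on all of
`ℂ`. -/
theorem vaisalaInv_vaisalaMap (z : ℂ) : vaisalaInv (vaisalaMap z) = z := by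
  have h := le_max_right z.re 0
  apply Complex.ext
  · simp [vaisalaInv]
  · simp only [vaisalaInv, vaisalaMap_re, vaisalaMap_im]
    set p := max z.re 0
    rcases le_total z.im 1 with h1 | h1
    · rw [min_eq_left h1, max_eq_left]
      · field_simp
        ring
      · rw [le_div_iff₀ (by positivity)]
        nlinarith [mul_nonneg h h, mul_nonneg (mul_nonneg h h) (sub_nonneg.2 h1),
          mul_nonneg h (sub_nonneg.2 h1)]
    · rw [min_eq_right h1, max_eq_right]
      · ring
      · rw [div_le_iff₀ (by positivity)]
        nlinarith [mul_nonneg h (sub_nonneg.2 h1)]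

theorem vaisalaMap_vaisalaInv (z : ℂ) : vaisalaMap (vaisalaInv z) = z := by
  have h := le_max_right z.re 0
  apply Complex.ext
  · simp [vaisalaInv]
  · simp only [vaisalaInv, vaisalaMap_im]
    set p := max z.re 0
    rcases le_total z.im (p + 1) with h1 | h1
    · have h2 : z.im / (p + 1) ≤ 1 := (div_le_one (by positivity)).2 h1
      have h3 : z.im = z.im / (p + 1) * (p + 1) := by field_simp
      rw [max_eq_left, min_eq_left h2]
      · linarith
      · generalize z.im / (p + 1) = t at *
        nlinarith
    · have h2 : 1 ≤ z.im / (p + 1) := (one_le_div (by positivity)).2 h1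
      have h3 : z.im = z.im / (p + 1) * (p + 1) := by field_simp
      rw [max_eq_right, min_eq_right (by linarith)]
      · ring
      · generalize z.im / (p + 1) = t at *
        nlinarith

theorem isHomeoOn_vaisalaMap : IsHomeoOn vaisalaMap upperHalf upperHalf :=
  ⟨{ toFun := fun z => ⟨vaisalaMap z, vaisalaMap_mem z.2⟩
     invFun := fun z => ⟨vaisalaInv z, vaisalaInv_mem z.2⟩
     left_inv := fun z => Subtype.ext (vaisalaInv_vaisalaMap z)
     right_inv := fun z => Subtype.ext (vaisalaMap_vaisalaInv z)
     continuous_toFun := (continuous_vaisalaMap.comp continuous_subtype_val).subtype_mk _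
     continuous_invFun := (continuous_vaisalaInv.comp continuous_subtype_val).subtype_mk _ },
    fun _ => rfl⟩

theorem isOpen_vaisalaMap_image {D : Set ℂ} (hD : IsOpen D) : IsOpen (vaisalaMap '' D) := by
  rw [image_eq_preimage_of_inverse vaisalaInv_vaisalaMap vaisalaMap_vaisalaInv]
  exact hD.preimage continuous_vaisalaInv

theorem vaisalaMap_image_upperHalf : vaisalaMap '' upperHalf = upperHalf := by
  apply Subset.antisymm
  · rintro _ ⟨z, hz, rfl⟩
    exact vaisalaMap_mem hz
  · exact fun z hz => ⟨vaisalaInv z, vaisalaInv_mem hz, vaisalaMap_vaisalaInv z⟩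

/-! ### Local stretching and semisolidity in the half-plane -/

/-- The ratio by which `vaisalaMap` changes the distance to the boundary of the half-plane. -/
noncomputable def vaisalaRatio (z : ℂ) : ℝ := (vaisalaMap z).im / z.im

theorem continuousOn_vaisalaRatio : ContinuousOn vaisalaRatio upperHalf :=
  (Complex.continuous_im.comp continuous_vaisalaMap).continuousOn.div
    Complex.continuous_im.continuousOn fun _ hz => ne_of_gt hz

theorem one_le_vaisalaRatio {z : ℂ} (hz : z ∈ upperHalf) : 1 ≤ vaisalaRatio z :=
  (one_le_div hz).2 (im_le_vaisalaMap_im hz)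

/-- With `p = max re 0` and `m = min im 1`, the increment of `p * m` splits as `(p' - p) * m' + p *
(m' - m)`. The first term is at most the horizontal step since `m' ≤ 1`. If `z.im ≤ 1`, the ratio is
`1 + p` and absorbs the second term; otherwise `m = m' = 1` and the second term vanishes. The
alternative `h` holds for all `z'` near `z`, enough for a speed bound. -/
theorem abs_vaisalaMap_im_sub_le {z z' : ℂ} (hz : z ∈ upperHalf) (hz' : z' ∈ upperHalf)
    (h : z.im ≤ 1 ∨ 1 < z'.im) :
    |(vaisalaMap z').im - (vaisalaMap z).im| ≤
      |z'.re - z.re| + vaisalaRatio z * |z'.im - z.im| := by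
  have hz0 : 0 < z.im := hz
  have hz0' : 0 < z'.im := hz'
  have hp := le_max_right z.re 0
  have hm' : 0 ≤ min z'.im 1 := le_min hz0'.le zero_le_one
  have h1 : |(max z'.re 0 - max z.re 0) * min z'.im 1| ≤ |z'.re - z.re| := by
    rw [abs_mul, abs_of_nonneg hm']
    exact (mul_le_of_le_one_right (abs_nonneg _) (min_le_right _ _)).trans
      (abs_max_sub_max_le_abs _ _ _)
  have h2 : |(z'.im - z.im) + max z.re 0 * (min z'.im 1 - min z.im 1)| ≤
      vaisalaRatio z * |z'.im - z.im| := by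
    rcases le_or_gt z.im 1 with hz1 | hz1
    · have hK : vaisalaRatio z = 1 + max z.re 0 := by
        rw [vaisalaRatio, vaisalaMap_im, min_eq_left hz1]
        field_simp
      have h3 : |min z'.im 1 - min z.im 1| ≤ |z'.im - z.im| := abs_inf_sub_inf_le_abs _ _ _
      calc _ ≤ |z'.im - z.im| + |max z.re 0 * (min z'.im 1 - min z.im 1)| := abs_add_le _ _
        _ ≤ |z'.im - z.im| + max z.re 0 * |z'.im - z.im| := by
            rw [abs_mul, abs_of_nonneg hp]
            gcongr
        _ = _ := by rw [hK]; ring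
    · have hz1' := h.resolve_left (not_le.2 hz1)
      rw [min_eq_right hz1.le, min_eq_right hz1'.le, sub_self, mul_zero, add_zero]
      exact le_mul_of_one_le_left (abs_nonneg _) (one_le_vaisalaRatio hz)
  calc _ = |(max z'.re 0 - max z.re 0) * min z'.im 1 +
        ((z'.im - z.im) + max z.re 0 * (min z'.im 1 - min z.im 1))| := by
          rw [vaisalaMap_im, vaisalaMap_im]; congr 1; ring
    _ ≤ _ := (abs_add_le _ _).trans (add_le_add h1 h2)

/-- For coordinate steps `x`, `y` and ratio `K ≥ 1`, the squared image step is at most `K² (x² + (x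
+ y)²)`. This is at most `3 K² (x² + y²)`, the difference being `K² ((x - y)² + y²)`. -/
theorem dist_vaisalaMap_le {z z' : ℂ} (hz : z ∈ upperHalf) (hz' : z' ∈ upperHalf)
    (h : z.im ≤ 1 ∨ 1 < z'.im) :
    dist (vaisalaMap z') (vaisalaMap z) ≤ √3 * vaisalaRatio z * dist z' z := by
  have h1 := abs_vaisalaMap_im_sub_le hz hz' h
  have hK := one_le_vaisalaRatio hz
  rw [dist_eq_norm, dist_eq_norm, Complex.norm_eq_sqrt_sq_add_sq, Complex.norm_eq_sqrt_sq_add_sq]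
  simp only [Complex.sub_re, Complex.sub_im, vaisalaMap_re]
  set K := vaisalaRatio z
  rw [← sq_abs (z'.re - z.re), ← sq_abs (z'.im - z.im),
    ← sq_abs ((vaisalaMap z').im - (vaisalaMap z).im)]
  have hx := abs_nonneg (z'.re - z.re)
  have hy := abs_nonneg (z'.im - z.im)
  have hv := abs_nonneg ((vaisalaMap z').im - (vaisalaMap z).im)
  generalize |z'.re - z.re| = x at *
  generalize |z'.im - z.im| = y at *
  generalize |(vaisalaMap z').im - (vaisalaMap z).im| = v at *
  have hxK : x ≤ K * x := le_mul_of_one_le_left hx hK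
  have h2 : v ^ 2 ≤ (K * (x + y)) ^ 2 := pow_le_pow_left₀ hv (by linarith) 2
  have h3 : x ^ 2 ≤ (K * x) ^ 2 := pow_le_pow_left₀ hx hxK 2
  have hK0 : 0 ≤ K := by linarith
  rw [show √3 * K = √(3 * K ^ 2) by rw [Real.sqrt_mul (by norm_num), Real.sqrt_sq hK0],
    ← Real.sqrt_mul (by positivity)]
  refine Real.sqrt_le_sqrt ?_
  nlinarith [mul_nonneg (sq_nonneg K) (sq_nonneg (x - y)), mul_nonneg (sq_nonneg K) (sq_nonneg y)]

/-- The image of a rectifiable curve under `vaisalaMap`, in arclength parametrization. -/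
theorem IsRectifiableCurve.exists_vaisalaMap_image {D : Set ℂ} (hD : D ⊆ upperHalf) {x y : ℂ}
    {γ : ℝ → ℂ} {a b : ℝ} (hγ : IsRectifiableCurve D x y γ a b) :
    ∃ (η : ℝ → ℂ) (c d : ℝ),
      IsRectifiableCurve (vaisalaMap '' D) (vaisalaMap x) (vaisalaMap y) η c d ∧
      ∀ ρ : ℂ → ℝ, ContinuousOn ρ (vaisalaMap '' D) → (∀ z ∈ vaisalaMap '' D, 0 ≤ ρ z) →
        lineIntegral ρ η c d ≤
          √3 * lineIntegral (fun z => ρ (vaisalaMap z) * vaisalaRatio z) γ a b := by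
  obtain ⟨g, hg, hgD, hg0, hg1, -, hgρ⟩ := hγ.exists_arclength
  have hgu : ∀ t, g t ∈ upperHalf := fun t => hD (hgD t)
  have hη : Continuous fun t => vaisalaMap (g t) := continuous_vaisalaMap.comp hg.continuous
  have hw : Continuous fun t => √3 * vaisalaRatio (g t) :=
    continuous_const.mul (continuousOn_vaisalaRatio.comp_continuous hg.continuous hgu)
  have hs : ∀ t, ∀ᶠ s in 𝓝[>] t, dist (vaisalaMap (g s)) (vaisalaMap (g t)) ≤
      √3 * vaisalaRatio (g t) * (s - t) := by
    intro t
    have hev : ∀ᶠ s in 𝓝[>] t, (g t).im ≤ 1 ∨ 1 < (g s).im := by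
      rcases le_or_gt (g t).im 1 with h | h
      · exact Eventually.of_forall fun _ => Or.inl h
      · exact (((Complex.continuous_im.comp hg.continuous).tendsto t).eventually
          (lt_mem_nhds h)).filter_mono nhdsWithin_le_nhds |>.mono fun _ => Or.inr
    filter_upwards [hev, self_mem_nhdsWithin] with s hs hst
    refine (dist_vaisalaMap_le (hgu t) (hgu s) hs).trans ?_
    have h1 := one_le_vaisalaRatio (hgu t)
    have h2 := hg.dist_le_mul s t
    rw [NNReal.coe_one, one_mul, Real.dist_eq, abs_of_pos (sub_pos.2 hst)] at h2
    gcongr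
  have hr : IsRectifiableCurve (vaisalaMap '' D) (vaisalaMap x) (vaisalaMap y)
      (fun t => vaisalaMap (g t)) 0 (curveLength γ a b) :=
    ⟨curveLength_nonneg _ _ _, hη.continuousOn,
      eVariationOn_ne_top_of_speed_le (curveLength_nonneg _ _ _) hη hw hs,
      fun t _ => mem_image_of_mem _ (hgD t), by rw [hg0], by rw [hg1]⟩
  refine ⟨_, _, _, hr, fun ρ hρ hρ0 => ?_⟩
  refine (hr.lineIntegral_le hη (fun t => mem_image_of_mem _ (hgD t)) hw hρ hρ0 hs).trans_eq ?_
  rw [hgρ, ← intervalIntegral.integral_const_mul]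
  refine intervalIntegral.integral_congr fun t _ => ?_
  ring

theorem qhDist_vaisalaMap_le {x y : ℂ} (hx : x ∈ upperHalf) (hy : y ∈ upperHalf) :
    qhDist upperHalf (vaisalaMap x) (vaisalaMap y) ≤ √3 * qhDist upperHalf x y := by
  have h3 : 0 < √3 := by positivity
  rw [← div_le_iff₀' h3]
  -- The segment shows that the infimum is over a nonempty set.
  refine le_csInf ⟨_, _, _, _, (isRectifiableCurve_lineMap
    (convex_upperHalf.segment_subset hx hy)).1, rfl⟩ ?_
  rintro _ ⟨γ, a, b, hγ, rfl⟩
  rw [div_le_iff₀' h3]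
  obtain ⟨η, c, d, hη, hle⟩ := hγ.exists_vaisalaMap_image subset_rfl
  rw [vaisalaMap_image_upperHalf] at hη hle
  have hne : (frontier upperHalf).Nonempty := by
    rw [frontier_upperHalf]; exact ⟨0, Complex.zero_im⟩
  refine hη.qhDist_le.trans ((hle _ (continuousOn_inv_bdryDist isOpen_upperHalf hne)
    fun z _ => inv_nonneg.2 (bdryDist_nonneg _ _)).trans_eq ?_)
  obtain ⟨g, -, hg, -, -, -, hgρ⟩ := hγ.exists_arclength
  rw [qhLength, hgρ, hgρ]
  congr 1
  -- The ratio cancels: `(Im f)⁻¹ * (Im f / Im z) = (Im z)⁻¹`.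
  refine intervalIntegral.integral_congr fun t _ => ?_
  have h1 : 0 < (g t).im := hg t
  have h2 : 0 < (vaisalaMap (g t)).im := vaisalaMap_mem (hg t)
  simp only [bdryDist_upperHalf (hg t), bdryDist_upperHalf (vaisalaMap_mem (hg t)), vaisalaRatio]
  field_simp

theorem vaisalaMap_isSemisolid :
    ∃ φ : NNReal ≃ₜ NNReal, (∀ t : NNReal, (φ t : ℝ) = √3 * (t : ℝ)) ∧
      IsSemisolid φ vaisalaMap upperHalf upperHalf := by
  have h : ∀ t : NNReal, (Homeomorph.mulLeft₀ (NNReal.sqrt 3) (by simp) t : ℝ) = √3 * (t : ℝ) := by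
    intro t
    simp
  refine ⟨_, h, fun x hx y hy => ?_⟩
  rw [h, Real.coe_toNNReal _ (qhDist_nonneg _ _ _)]
  exact qhDist_vaisalaMap_le hx hy

/-! ### Failure of semisolidity in quadrants -/

theorem le_bdryDist_of_ball_subset {X : Type*} [MetricSpace X] {G : Set X} (hG : IsOpen G)
    (hne : (frontier G).Nonempty) {z : X} {r : ℝ} (h : Metric.ball z r ⊆ G) :
    r ≤ bdryDist G z := by
  refine (Metric.le_infDist hne).2 fun w hw => ?_
  by_contra hlt
  rw [hG.frontier_eq] at hw
  exact hw.2 (h (by rwa [Metric.mem_ball, dist_comm, ← not_le]))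

/-- The quadrant cut off the upper half-plane by the vertical line through `R`. -/
def quadrant (R : ℝ) : Set ℂ := {z | R < z.re} ∩ upperHalf

theorem isOpen_quadrant (R : ℝ) : IsOpen (quadrant R) :=
  (isOpen_lt continuous_const Complex.continuous_re).inter isOpen_upperHalf

theorem convex_quadrant (R : ℝ) : Convex ℝ (quadrant R) :=
  (convex_halfSpace_re_gt R).inter convex_upperHalf

theorem mk_mem_frontier_quadrant (R : ℝ) {y : ℝ} (hy : 0 < y) :
    (⟨R, y⟩ : ℂ) ∈ frontier (quadrant R) := by
  rw [(isOpen_quadrant R).frontier_eq]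
  refine ⟨?_, fun h => lt_irrefl R h.1⟩
  have hc : Continuous fun t : ℝ => (⟨t, y⟩ : ℂ) :=
    continuous_complex_mk continuous_id continuous_const
  have ht : Tendsto (fun t : ℝ => (⟨t, y⟩ : ℂ)) (𝓝[>] R) (𝓝 ⟨R, y⟩) :=
    (hc.tendsto R).mono_left nhdsWithin_le_nhds
  refine mem_closure_of_tendsto ht ?_
  filter_upwards [self_mem_nhdsWithin] with t ht
  exact ⟨ht, hy⟩

/-- The segment has length `1 / 4` and lies in `S`, where the distance to the boundary is at least
`1 / 4`. -/
theorem qhDist_quadrant_le_one (R : ℝ) :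
    qhDist (quadrant R) ⟨R + 1 / 4, 1 / 2⟩ ⟨R + 1 / 4, 3 / 4⟩ ≤ 1 := by
  set S : Set ℂ := {z | R + 1 / 4 ≤ z.re} ∩ {z | 1 / 2 ≤ z.im} with hS
  have hSc : Convex ℝ S := (convex_halfSpace_re_ge _).inter (convex_halfSpace_im_ge _)
  have hseg : segment ℝ (⟨R + 1 / 4, 1 / 2⟩ : ℂ) ⟨R + 1 / 4, 3 / 4⟩ ⊆ S :=
    hSc.segment_subset ⟨le_refl (R + 1 / 4), le_refl (1 / 2 : ℝ)⟩
      ⟨le_refl (R + 1 / 4), show (1 / 2 : ℝ) ≤ 3 / 4 by norm_num⟩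
  have hSD : S ⊆ quadrant R := fun z ⟨h1, h2⟩ => by
    simp only [mem_ofPred_eq] at h1 h2
    exact ⟨show R < z.re by linarith, show 0 < z.im by linarith⟩
  have hδ : ∀ z ∈ S, 1 / 4 ≤ bdryDist (quadrant R) z := by
    rintro z ⟨h1, h2⟩
    refine le_bdryDist_of_ball_subset (isOpen_quadrant R)
      ⟨_, mk_mem_frontier_quadrant R one_pos⟩ fun w hw => ?_
    rw [Metric.mem_ball, dist_eq_norm] at hw
    have h3 := (abs_lt.1 ((Complex.abs_re_le_norm (w - z)).trans_lt hw)).1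
    have h4 := (abs_lt.1 ((Complex.abs_im_le_norm (w - z)).trans_lt hw)).1
    rw [Complex.sub_re] at h3
    rw [Complex.sub_im] at h4
    simp only [mem_ofPred_eq] at h1 h2
    exact ⟨show R < w.re by linarith, show 0 < w.im by linarith⟩
  obtain ⟨hc, hlen⟩ := isRectifiableCurve_lineMap (hseg.trans hSD)
  refine hc.qhDist_le.trans ((hc.qhLength_le_mul (by norm_num) (S := S)
    (isRectifiableCurve_lineMap hseg).1.mapsTo hδ).trans ?_)
  have hd : dist (⟨R + 1 / 4, 1 / 2⟩ : ℂ) ⟨R + 1 / 4, 3 / 4⟩ ≤ 1 / 4 := by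
    rw [dist_eq_norm]
    refine (Complex.norm_le_abs_re_add_abs_im _).trans ?_
    rw [Complex.sub_re, Complex.sub_im, abs_of_nonneg (by simp), abs_of_nonpos (by norm_num)]
    norm_num
  linarith

theorem log_le_qhDist_vaisalaMap_quadrant {R : ℝ} (hR : 0 < R) :
    Real.log (R / 2) ≤ qhDist (vaisalaMap '' quadrant R)
      (vaisalaMap ⟨R + 1 / 4, 1 / 2⟩) (vaisalaMap ⟨R + 1 / 4, 3 / 4⟩) := by
  have hsub : quadrant R ⊆ upperHalf := inter_subset_right
  have hseg := (isRectifiableCurve_lineMap ((convex_quadrant R).segment_subset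
    (x := ⟨R + 1 / 4, 1 / 2⟩) (y := ⟨R + 1 / 4, 3 / 4⟩)
    ⟨by simp, show (0 : ℝ) < 1 / 2 by norm_num⟩ ⟨by simp, show (0 : ℝ) < 3 / 4 by norm_num⟩)).1
  -- Only existence matters here: the image of the segment makes the set of lengths nonempty, as the
  -- lower bound on its infimum requires.
  obtain ⟨η, c, d, hη, -⟩ := hseg.exists_vaisalaMap_image hsub
  refine le_csInf ⟨_, η, c, d, hη, rfl⟩ ?_
  rintro _ ⟨γ, a, b, hγ, rfl⟩
  have hopen := isOpen_vaisalaMap_image (isOpen_quadrant R)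
  have hp : (⟨R, 1 / 2⟩ : ℂ) ∈ frontier (quadrant R) :=
    mk_mem_frontier_quadrant R (by norm_num)
  have hfp : vaisalaMap ⟨R, 1 / 2⟩ ∈ frontier (vaisalaMap '' quadrant R) := by
    rw [(isOpen_quadrant R).frontier_eq] at hp
    rw [hopen.frontier_eq]
    refine ⟨image_closure_subset_closure_image continuous_vaisalaMap
      (mem_image_of_mem _ hp.1), ?_⟩
    rintro ⟨z, hz, hzp⟩
    have := congrArg vaisalaInv hzp
    rw [vaisalaInv_vaisalaMap, vaisalaInv_vaisalaMap] at this
    exact hp.2 (this ▸ hz)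
  refine le_trans ?_ (hγ.log_dist_sub_log_dist_le hopen hfp)
  have e0 : (vaisalaMap ⟨R, 1 / 2⟩).im = (R + 1) * (1 / 2) :=
    vaisalaMap_im_of_le hR.le (by norm_num)
  have e1 : (vaisalaMap ⟨R + 1 / 4, 1 / 2⟩).im = (R + 1 / 4 + 1) * (1 / 2) :=
    vaisalaMap_im_of_le (by simp only; linarith) (by norm_num)
  have e2 : (vaisalaMap ⟨R + 1 / 4, 3 / 4⟩).im = (R + 1 / 4 + 1) * (3 / 4) :=
    vaisalaMap_im_of_le (by simp only; linarith) (by norm_num)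
  have h1 : dist (vaisalaMap ⟨R + 1 / 4, 1 / 2⟩) (vaisalaMap ⟨R, 1 / 2⟩) ≤ 1 / 2 := by
    rw [dist_eq_norm]
    refine (Complex.norm_le_abs_re_add_abs_im _).trans ?_
    rw [Complex.sub_re, Complex.sub_im, e0, e1, vaisalaMap_re, vaisalaMap_re,
      abs_of_nonneg (by simp), abs_of_nonneg (by linarith)]
    linarith
  have h1' : 0 < dist (vaisalaMap ⟨R + 1 / 4, 1 / 2⟩) (vaisalaMap ⟨R, 1 / 2⟩) := by
    refine dist_pos.2 fun h => ?_
    have := congrArg Complex.re h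
    simp at this
  have h2 : R / 4 ≤ dist (vaisalaMap ⟨R + 1 / 4, 3 / 4⟩) (vaisalaMap ⟨R, 1 / 2⟩) := by
    rw [dist_eq_norm]
    refine le_trans ?_ (Complex.abs_im_le_norm _)
    rw [Complex.sub_im, e0, e2]
    refine le_trans ?_ (le_abs_self _)
    linarith
  have h3 : Real.log (R / 2) = Real.log (R / 4) - Real.log (1 / 2) := by
    rw [← Real.log_div (by positivity) (by norm_num)]
    congr 1; ring
  rw [h3]
  exact sub_le_sub (Real.log_le_log (by positivity) h2) (Real.log_le_log h1' h1)

theorem not_forall_subdomain_isSemisolid_vaisalaMap (ψ : NNReal ≃ₜ NNReal) :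
    ¬ ∀ D : Set ℂ, IsOpen D → IsConnected D → D ⊂ upperHalf →
      IsSemisolid ψ vaisalaMap D (vaisalaMap '' D) := by
  intro h
  obtain ⟨M, hM⟩ := (isCompact_Icc (a := (0 : NNReal)) (b := 1)).bddAbove_image
    ψ.continuous.continuousOn
  -- Chosen so that `log (R / 2) = M + 1` exceeds the bound `M` of `ψ` on `[0, 1]`.
  set R : ℝ := 2 * Real.exp (M + 1) with hR
  have hR0 : 0 < R := by positivity
  have m1 : (⟨R + 1 / 4, 1 / 2⟩ : ℂ) ∈ quadrant R :=
    ⟨by simp, show (0 : ℝ) < 1 / 2 by norm_num⟩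
  have m2 : (⟨R + 1 / 4, 3 / 4⟩ : ℂ) ∈ quadrant R :=
    ⟨by simp, show (0 : ℝ) < 3 / 4 by norm_num⟩
  have hss : quadrant R ⊂ upperHalf := by
    refine ⟨inter_subset_right, fun hsub => ?_⟩
    have : (⟨R, 1⟩ : ℂ) ∈ quadrant R := hsub (show (0 : ℝ) < 1 by norm_num)
    exact lt_irrefl R this.1
  have h1 := h _ (isOpen_quadrant R) ((convex_quadrant R).isConnected ⟨_, m1⟩) hss _ m1 _ m2
  have h2 := log_le_qhDist_vaisalaMap_quadrant hR0
  have h3 : ψ (qhDist (quadrant R) ⟨R + 1 / 4, 1 / 2⟩ ⟨R + 1 / 4, 3 / 4⟩).toNNReal ≤ M := by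
    refine hM (mem_image_of_mem _ ⟨zero_le, ?_⟩)
    rw [Real.toNNReal_le_iff_le_coe]
    exact qhDist_quadrant_le_one R
  have h4 : Real.log (R / 2) = M + 1 := by
    rw [hR, mul_div_cancel_left₀ _ (two_ne_zero' ℝ), Real.log_exp]
  have h5 : (ψ (qhDist (quadrant R) ⟨R + 1 / 4, 1 / 2⟩ ⟨R + 1 / 4, 3 / 4⟩).toNNReal : ℝ) ≤ M := h3
  linarith

/-! ### Failure of local weak quasisymmetry -/

theorem vaisalaMap_not_isLocallyWeaklyQuasisymmetric {H q : ℝ} (hH : 1 ≤ H) (hq0 : 0 < q)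
    (hq1 : q < 1) : ¬ IsLocallyWeaklyQuasisymmetric q H vaisalaMap upperHalf := by
  intro h
  -- A vertical step `s` becomes at least `(R + 1) * s` and a horizontal one at most `2 * s`, so
  -- quasisymmetry would give `(2 * H + 1) * s ≤ 2 * H * s`. The choice `s = q / 4` keeps both
  -- points in the ball of radius `q / 2` and below height 1.
  set R : ℝ := 2 * H with hR
  set s : ℝ := q / 4 with hs
  have hz : (⟨R, 1 / 2⟩ : ℂ) ∈ upperHalf := show (0 : ℝ) < 1 / 2 by norm_num
  -- The ball meets the half-plane in a convex set, which is therefore its own component.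
  have hball : componentBall upperHalf ⟨R, 1 / 2⟩ (q * bdryDist upperHalf ⟨R, 1 / 2⟩) =
      Metric.ball ⟨R, 1 / 2⟩ (q * (1 / 2)) ∩ upperHalf := by
    rw [componentBall, bdryDist_upperHalf hz]
    exact ((convex_ball _ _).inter convex_upperHalf).isPreconnected.connectedComponentIn
      ⟨Metric.mem_ball_self (by positivity), hz⟩
  have key := h ⟨R, 1 / 2⟩ hz
  rw [hball] at key
  have ea : dist (⟨R, 1 / 2⟩ : ℂ) ⟨R, 1 / 2 + s⟩ = s := by
    rw [Complex.dist_of_re_eq, Real.dist_eq, abs_of_nonpos] <;> simp only <;> linarith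
  have eb : dist (⟨R, 1 / 2⟩ : ℂ) ⟨R + s, 1 / 2⟩ = s := by
    rw [Complex.dist_of_im_eq, Real.dist_eq, abs_of_nonpos] <;> simp only <;> linarith
  have hx : (⟨R, 1 / 2⟩ : ℂ) ∈ Metric.ball (⟨R, 1 / 2⟩ : ℂ) (q * (1 / 2)) ∩ upperHalf :=
    ⟨Metric.mem_ball_self (by positivity), hz⟩
  have ha : (⟨R, 1 / 2 + s⟩ : ℂ) ∈ Metric.ball (⟨R, 1 / 2⟩ : ℂ) (q * (1 / 2)) ∩ upperHalf :=
    ⟨by rw [Metric.mem_ball, dist_comm, ea]; linarith, show 0 < 1 / 2 + s by linarith⟩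
  have hb : (⟨R + s, 1 / 2⟩ : ℂ) ∈ Metric.ball (⟨R, 1 / 2⟩ : ℂ) (q * (1 / 2)) ∩ upperHalf :=
    ⟨by rw [Metric.mem_ball, dist_comm, eb]; linarith, hz⟩
  have hle := key _ hx _ ha _ hb (by rw [ea, eb])
  have hR0 : 0 ≤ R := by linarith
  have e0 : (vaisalaMap ⟨R, 1 / 2⟩).im = (R + 1) * (1 / 2) :=
    vaisalaMap_im_of_le hR0 (by norm_num)
  have e1 : (vaisalaMap ⟨R, 1 / 2 + s⟩).im = (R + 1) * (1 / 2 + s) :=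
    vaisalaMap_im_of_le hR0 (by simp only; linarith)
  have e2 : (vaisalaMap ⟨R + s, 1 / 2⟩).im = (R + s + 1) * (1 / 2) :=
    vaisalaMap_im_of_le (by simp only; linarith) (by norm_num)
  have h1 : (R + 1) * s ≤ dist (vaisalaMap ⟨R, 1 / 2⟩) (vaisalaMap ⟨R, 1 / 2 + s⟩) := by
    rw [dist_comm, dist_eq_norm]
    refine le_trans ?_ (Complex.abs_im_le_norm _)
    rw [Complex.sub_im, e0, e1]
    refine le_trans ?_ (le_abs_self _)
    linarith
  have h2 : dist (vaisalaMap ⟨R, 1 / 2⟩) (vaisalaMap ⟨R + s, 1 / 2⟩) ≤ 2 * s := by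
    rw [dist_comm, dist_eq_norm]
    refine (Complex.norm_le_abs_re_add_abs_im _).trans ?_
    rw [Complex.sub_re, Complex.sub_im, e0, e2, vaisalaMap_re, vaisalaMap_re,
      abs_of_nonneg (by simp only; linarith), abs_of_nonneg (by linarith)]
    simp only
    linarith
  have h3 := mul_le_mul_of_nonneg_left h2 (by linarith : 0 ≤ H)
  nlinarith

end Semisolidity

theorem mainTheorem5 :
    -- the upper half-plane is a proper domain and the map is a homeomorphism of it onto itself
    Semisolidity.IsProperDomain Semisolidity.upperHalf ∧
    Semisolidity.IsHomeoOn Semisolidity.vaisalaMap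
      Semisolidity.upperHalf Semisolidity.upperHalf ∧
    -- (a)
    (∃ φ : NNReal ≃ₜ NNReal, (∀ t : NNReal, (φ t : ℝ) = Real.sqrt 3 * (t : ℝ)) ∧
      Semisolidity.IsSemisolid φ Semisolidity.vaisalaMap
        Semisolidity.upperHalf Semisolidity.upperHalf) ∧
    -- (b)
    (∀ ψ : NNReal ≃ₜ NNReal,
      ¬ ∀ D : Set ℂ, IsOpen D → IsConnected D → D ⊂ Semisolidity.upperHalf →
        Semisolidity.IsSemisolid ψ Semisolidity.vaisalaMap D (Semisolidity.vaisalaMap '' D)) ∧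
    -- (c)
    (∀ H q : ℝ, 1 ≤ H → 0 < q → q < 1 →
      ¬ Semisolidity.IsLocallyWeaklyQuasisymmetric q H
        Semisolidity.vaisalaMap Semisolidity.upperHalf) := by
  exact ⟨Semisolidity.isProperDomain_upperHalf, Semisolidity.isHomeoOn_vaisalaMap,
    Semisolidity.vaisalaMap_isSemisolid,
    Semisolidity.not_forall_subdomain_isSemisolid_vaisalaMap,
    fun _ _ hH hq0 hq1 =>
      Semisolidity.vaisalaMap_not_isLocallyWeaklyQuasisymmetric hH hq0 hq1⟩
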